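/- Let $0<q<1$. For complex $a$ put $(a;q)_n=\prod_{k=0}^{n-1}(1-aq^k)$, $(a;q)_\infty=\prod_{k=0}^{\infty}(1-aq^k)$, write $(a_1,\dots,a_m;q)_n=(a_1;q)_n\cdots(a_m;q)_n$ (also for $n=\infty$), and let $$ {}_r\phi_s\!\left({a_1,\dots,a_r\atop b_1,\dots,b_s};q,z\right)=\sum_{n=0}^\infty\frac{(a_1,\dots,a_r;q)_n}{(q,b_1,\dots,b_s;q)_n}\left((-1)^nq^{n(n-1)/2}\right)^{1+s-r}z^n . $$ **(i)** Let $\alpha,a,b,c,d,\beta$ be complex numbers with $a,b,c,\beta\neq0$, $\alpha\ne1$, such that none of $\alpha a,\alpha b,c,d,q\alpha/c$ is of the form $q^{-k}$ with an integer $k\ge0$ (so that no denominator vanishes). If $|\alpha ab/q|<1$, then $$ \frac{(\alpha q,\alpha ab/q;q)_\infty}{(\alpha a,\alpha b;q)_\infty}\;{}_3\phi_2\!\left({q/a,\,q/b,\,\beta\atop c,\,d};q,\frac{\alpha ab}{q}\right) =\sum_{n=0}^\infty\frac{(1-\alpha q^{2n})(\alpha,q/a,q/b,q\alpha/c;q)_n(\alpha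 abc)^nq^{n^2-2n}}{(1-\alpha)(q,\alpha a,\alpha b,c;q)_n}\;{}_3\phi_2\!\left({q^{-n},\,\alpha q^n,\,d/\beta\atop d,\,q\alpha/c};q,\frac{q\beta}{c}\right), $$ where the series on both sides converge absolutely. **(ii)** The same holds when $a=0$ or $b=0$ is allowed, provided that $(q/a;q)_na^n$ and $(q/b;q)_nb^n$ are read throughout as the polynomials $\prod_{k=1}^n(a-q^k)$ and $\prod_{k=1}^n(b-q^k)$ (that is, as their limits when $a=0$ or $b=0$). **(iii)** In particular ($a=b=d=0$, $c=-q$, with $\beta$ replaced by $-q\beta$) one has Andrews' identity: for complex $\alpha,\beta$ with $\alpha\neq1$ such that neither $q\alpha$ nor $-\alpha$ is of the form $q^{-k}$ with an integer $k\ge0$, $$ \sum_{n=0}^\infty\frac{q^{n^2}(-q\beta;q)_n\alpha^n}{(q^2;q^2)_n} =\frac1{(q\alpha;q)_\infty}\sum_{n=0}^\infty\frac{(1-\alpha q^{2n})(\alpha^2;q^2)_n(-\alpha)^nq^{2n^2}}{(1-\alpha)(q^2;q^2)_n}\;{}_2\phi_1\!\left({q^{-n},\,\alpha q^n\atop-\alpha};q,q\beta\right),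 $$ where both series converge absolutely. -/

import Mathlib

open scoped BigOperators

noncomputable section

/-- The finite `q`-shifted factorial `(a; q)_n = ∏_{k=0}^{n-1} (1 - a q^k)`. -/
def qPoch (a q : ℂ) (n : ℕ) : ℂ := ∏ k ∈ Finset.range n, (1 - a * q ^ k)

/-- The infinite `q`-shifted factorial `(a; q)_∞ = ∏_{k=0}^∞ (1 - a q^k)`. -/
def qPochInf (a q : ℂ) : ℂ := ∏' k : ℕ, (1 - a * q ^ k)

/-- The `n`-th term of the basic hypergeometric series `_rφ_s(as; bs; q, z)`, where `r` and `s`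
are the lengths of the lists `as` and `bs`. -/
def basicHypergeometricTerm (as bs : List ℂ) (q z : ℂ) (n : ℕ) : ℂ :=
  (as.map fun a => qPoch a q n).prod / (qPoch q q n * (bs.map fun b => qPoch b q n).prod) *
    ((-1) ^ n * q ^ (n * (n - 1) / 2)) ^ (1 + (bs.length : ℤ) - (as.length : ℤ)) * z ^ n

/-- The basic hypergeometric series `_rφ_s(as; bs; q, z)`. -/
def basicHypergeometric (as bs : List ℂ) (q z : ℂ) : ℂ :=
  ∑' n : ℕ, basicHypergeometricTerm as bs q z n

/-- The polynomial `∏_{k=1}^{n} (a - q^k)` in `a`: it is `(q/a; q)_n a^n` for `a ≠ 0`, and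
its value at `a = 0` is the limit of that product as `a → 0`. -/
def qPochDivMulPow (a q : ℂ) (n : ℕ) : ℂ := ∏ k ∈ Finset.range n, (a - q ^ (k + 1))

theorem qPochDivMulPow_of_ne_zero {a : ℂ} (ha : a ≠ 0) (q : ℂ) (n : ℕ) :
    qPochDivMulPow a q n = qPoch (q / a) q n * a ^ n := by
  have h : a ^ n = ∏ _k ∈ Finset.range n, a := by simp
  rw [qPochDivMulPow, qPoch, h, ← Finset.prod_mul_distrib]
  refine Finset.prod_congr rfl fun k _ => ?_
  field_simp
  ring

theorem multipliable_qPochInf (a : ℂ) {q : ℂ} (hq : ‖q‖ < 1) :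
    Multipliable fun k : ℕ => 1 - a * q ^ k := by
  have h : Summable fun k : ℕ => ‖-(a * q ^ k)‖ := by
    simp only [norm_neg, norm_mul, norm_pow]
    exact (summable_geometric_of_lt_one (norm_nonneg q) hq).mul_left _
  simpa [sub_eq_add_neg] using multipliable_one_add_of_summable h

end

section

open Filter Topology Finset

/-! Both sides are the two ways of summing one absolutely convergent double series. Its (j, m) term
is the j-th term of the left-hand ₃φ₂ times (αq; q)_{2j} times the m-th term of a very-well-poised
series with base α q^{2j}.

Summing over m first uses `tsum_vwpTerm` with s = q^j: together with (αq; q)_{2j} it gives (αq,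
αab/q; q)_∞, which does not depend on j, so the left-hand ₃φ₂ factors out. Summing along j + m = n
first, the factorials merge (`phiTerm_mul_vwpTerm`) into a very-well-poised factor in n times a
terminating ₃φ₂ of argument q, which `sum_terminating_transformation` turns into the one in the
theorem.

The terminating transformation comes from expanding (β; q)_j / (d; q)_j by q-Chu–Vandermonde,
exchanging sums, and summing the inner series by the other form of q-Chu–Vandermonde. The
very-well-poised sum comes from a telescoping recursion a → aq, iterated to a → 0; the remaining
constant is read off at a = sq, where the series has a single term.

Homogeneous products such as `qDiffProd` keep everything polynomial in a, b and β, so the values 0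
in (ii) and (iii) need no limit argument. -/

/-- The homogeneous `q`-shifted factorial `∏_{k=0}^{n-1} (x - y q^k)`. -/
def qDiffProd (x y q : ℂ) (n : ℕ) : ℂ := ∏ k ∈ range n, (x - y * q ^ k)

/-! ### Algebra of finite shifted factorials. -/

section Basic

variable {q : ℂ}

@[simp] theorem qPoch_zero (a q : ℂ) : qPoch a q 0 = 1 := by simp [qPoch]

@[simp] theorem qDiffProd_zero (x y q : ℂ) : qDiffProd x y q 0 = 1 := by simp [qDiffProd]

theorem qPoch_succ (a q : ℂ) (n : ℕ) : qPoch a q (n + 1) = qPoch a q n * (1 - a * q ^ n) := by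
  simp [qPoch, prod_range_succ]

theorem qDiffProd_succ (x y q : ℂ) (n : ℕ) :
    qDiffProd x y q (n + 1) = qDiffProd x y q n * (x - y * q ^ n) := by
  simp [qDiffProd, prod_range_succ]

theorem qDiffProd_one_left (y q : ℂ) (n : ℕ) : qDiffProd 1 y q n = qPoch y q n := rfl

theorem qPochDivMulPow_eq_qDiffProd (a q : ℂ) (n : ℕ) :
    qPochDivMulPow a q n = qDiffProd a q q n := by
  simp [qPochDivMulPow, qDiffProd, pow_succ']

theorem qDiffProd_add (x y q : ℂ) (m n : ℕ) :
    qDiffProd x y q (m + n) = qDiffProd x y q m * qDiffProd x (y * q ^ m) q n := by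
  simp [qDiffProd, prod_range_add, pow_add, mul_assoc]

theorem qPoch_add (a q : ℂ) (m n : ℕ) :
    qPoch a q (m + n) = qPoch a q m * qPoch (a * q ^ m) q n := by
  simp only [← qDiffProd_one_left, qDiffProd_add]

theorem qPoch_succ' (a q : ℂ) (n : ℕ) : qPoch a q (n + 1) = (1 - a) * qPoch (a * q) q n := by
  rw [add_comm, qPoch_add]; simp [qPoch]

theorem qDiffProd_succ' (x y q : ℂ) (n : ℕ) :
    qDiffProd x y q (n + 1) = (x - y) * qDiffProd x (y * q) q n := by
  rw [add_comm, qDiffProd_add]; simp [qDiffProd]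

theorem qDiffProd_mul_mul (x y z q : ℂ) (n : ℕ) :
    qDiffProd (x * z) (y * z) q n = z ^ n * qDiffProd x y q n := by
  induction n with
  | zero => simp
  | succ n ih => rw [qDiffProd_succ, qDiffProd_succ, ih]; ring

theorem qPoch_div_mul_pow {β : ℂ} (hβ : β ≠ 0) (d q : ℂ) (n : ℕ) :
    qPoch (d / β) q n * β ^ n = qDiffProd β d q n := by
  have := qDiffProd_mul_mul 1 (d / β) β q n
  rw [one_mul, div_mul_cancel₀ _ hβ, qDiffProd_one_left] at this
  rw [this, mul_comm]

theorem qPoch_ne_zero {a : ℂ} (h : ∀ k : ℕ, a * q ^ k ≠ 1) (n : ℕ) : qPoch a q n ≠ 0 :=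
  prod_ne_zero_iff.2 fun k _ => sub_ne_zero.2 (h k).symm

theorem mul_pow_ne_one (hq : ‖q‖ < 1) (k : ℕ) : q * q ^ k ≠ 1 := by
  intro h
  have h1 : ‖q ^ (k + 1)‖ < 1 := by
    rw [norm_pow]; exact pow_lt_one₀ (norm_nonneg _) hq k.succ_ne_zero
  rw [pow_succ', h] at h1
  simp at h1

theorem qPoch_self_ne_zero (hq : ‖q‖ < 1) (n : ℕ) : qPoch q q n ≠ 0 :=
  qPoch_ne_zero (mul_pow_ne_one hq) n

theorem qPoch_neg_zpow_eq_zero (hq0 : q ≠ 0) {n k : ℕ} (h : n < k) :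
    qPoch (q ^ (-(n : ℤ))) q k = 0 :=
  prod_eq_zero (mem_range.2 h) (by simp [hq0])

theorem choose_two_add (m n : ℕ) :
    (m + n).choose 2 = m.choose 2 + n.choose 2 + m * n := by
  induction n with
  | zero => simp
  | succ n ih =>
    rw [← add_assoc, Nat.choose_succ_succ' (m + n), Nat.choose_succ_succ' n, ih]
    simp; ring

theorem choose_two_succ (n : ℕ) : (n + 1).choose 2 = n + n.choose 2 := by
  simp [Nat.choose_succ_succ']

end Basic

/-! ### Terminating q-Chu–Vandermonde sums and the ₃φ₂ transformation. -/

section Terminating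

variable {q : ℂ}

/-- The terminating `q`-Chu–Vandermonde sum, in a form polynomial in the numerator parameter. -/
theorem sum_qDiffProd_div (hq : ‖q‖ < 1) (n : ℕ) : ∀ {β d : ℂ}, (∀ k : ℕ, d * q ^ k ≠ 1) →
    ∑ k ∈ range (n + 1),
      qDiffProd (q ^ n) 1 q k / qPoch q q k * (qDiffProd β d q k / qPoch d q k) =
    qPoch β q n / qPoch d q n := by
  induction n with
  | zero => intros; simp
  | succ n ih =>
    intro β d hd
    have hd' : ∀ k : ℕ, d * q * q ^ k ≠ 1 := fun k => by
      rw [mul_assoc, ← pow_succ']; exact hd _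
    have hd0 : 1 - d ≠ 0 := sub_ne_zero.2 (by simpa using (hd 0).symm)
    set u : ℕ → ℂ := fun k => qDiffProd (q ^ n) 1 q k / qPoch q q k with hu
    set v : ℕ → ℂ := fun k => qDiffProd β d q k / qPoch d q k with hv
    -- The q-Pascal rule. Summation by parts then moves the difference onto `v`, and `v k - v (k +
    -- 1)` has the factor 1 - β, leaving the sum for n with β, d replaced by βq, dq.
    have hrec : ∀ k, qDiffProd (q ^ (n + 1)) 1 q (k + 1) / qPoch q q (k + 1) =
        q ^ (k + 1) * u (k + 1) - q ^ k * u k := by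
      intro k
      have h1 := qPoch_self_ne_zero hq k
      have h2 : 1 - q * q ^ k ≠ 0 := sub_ne_zero.2 (mul_pow_ne_one hq k).symm
      have h3 := qDiffProd_mul_mul (q ^ n) 1 q q k
      rw [one_mul] at h3
      simp only [hu]
      rw [qDiffProd_succ', one_mul, pow_succ q n, h3, qPoch_succ, qDiffProd_succ]
      field_simp
      ring
    have hu0 : u (n + 1) = 0 := by
      simp only [hu]; rw [qDiffProd_succ]; simp
    rw [sum_range_succ', qPoch_succ', qPoch_succ', mul_div_mul_comm, ← ih hd']
    simp only [hrec]
    have hshift : ∑ k ∈ range (n + 1), q ^ (k + 1) * u (k + 1) * v (k + 1) + 1 =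
        ∑ k ∈ range (n + 1), q ^ k * u k * v k := by
      have := sum_range_succ' (fun k => q ^ k * u k * v k) (n + 1)
      rw [sum_range_succ, hu0] at this
      simpa [hu, hv] using this.symm
    have : ∑ k ∈ range (n + 1), (q ^ (k + 1) * u (k + 1) - q ^ k * u k) * v (k + 1) + 1 =
        ∑ k ∈ range (n + 1), (q ^ k * u k * v k - q ^ k * u k * v (k + 1)) := by
      rw [sum_sub_distrib, ← hshift]
      simp only [sub_mul, sum_sub_distrib]
      ring
    simp only [qDiffProd_zero, qPoch_zero, div_one, mul_one]
    rw [this, mul_sum]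
    refine sum_congr rfl fun k _ => ?_
    have h1 : qPoch d q k ≠ 0 := qPoch_ne_zero hd k
    have h2 : 1 - d * q ^ k ≠ 0 := sub_ne_zero.2 (hd k).symm
    have h3 : qPoch (d * q) q k = qPoch d q k * (1 - d * q ^ k) / (1 - d) := by
      rw [eq_div_iff hd0, ← qPoch_succ, qPoch_succ', mul_comm]
    have h4 := qPoch_self_ne_zero hq k
    rw [mul_comm d] at h2
    simp only [hu, hv]
    rw [qDiffProd_mul_mul, h3, qDiffProd_succ, qPoch_succ, mul_comm d (q ^ k)]
    field_simp
    ring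

/-- The terminating `q`-Chu–Vandermonde sum with argument `q`. -/
theorem sum_qPoch_neg_zpow (hq0 : q ≠ 0) (hq : ‖q‖ < 1) (n : ℕ) :
    ∀ {x y : ℂ}, (∀ k : ℕ, y * q ^ k ≠ 1) →
    ∑ k ∈ range (n + 1),
      qPoch (q ^ (-(n : ℤ))) q k * q ^ k / qPoch q q k * (qPoch x q k / qPoch y q k) =
    qDiffProd x y q n / qPoch y q n := by
  induction n with
  | zero => intros; simp
  | succ n ih =>
    intro x y hy
    have hy' : ∀ k : ℕ, y * q * q ^ k ≠ 1 := fun k => by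
      rw [mul_assoc, ← pow_succ']; exact hy _
    have hy0 : 1 - y ≠ 0 := sub_ne_zero.2 (by simpa using (hy 0).symm)
    set u : ℕ → ℂ := fun k => qPoch (q ^ (-(n : ℤ))) q k * q ^ k / qPoch q q k with hu
    set v : ℕ → ℂ := fun k => qPoch x q k / qPoch y q k with hv
    -- The q-Pascal rule with weights q^{-k}. Here `v k - v (k + 1)` carries q^k (x - y), so the
    -- weight cancels and only y is shifted to yq.
    have hrec : ∀ k, qPoch (q ^ (-((n + 1 : ℕ) : ℤ))) q (k + 1) * q ^ (k + 1) /
          qPoch q q (k + 1) = u (k + 1) / q ^ (k + 1) - u k / q ^ k := by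
      intro k
      have h1 := qPoch_self_ne_zero hq k
      have h2 : 1 - q * q ^ k ≠ 0 := sub_ne_zero.2 (mul_pow_ne_one hq k).symm
      have h3 : q ^ (-((n + 1 : ℕ) : ℤ)) * q = q ^ (-(n : ℤ)) := by
        rw [← zpow_add_one₀ hq0]; congr 1; push_cast; ring
      have h4 : q ^ (-((n + 1 : ℕ) : ℤ)) = q ^ (-(n : ℤ)) / q := by
        rw [← h3]; field_simp
      simp only [hu]
      rw [qPoch_succ', h3, h4, qPoch_succ, qPoch_succ]
      field_simp
      ring
    have hu0 : u (n + 1) = 0 := by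
      simp only [hu]; rw [qPoch_neg_zpow_eq_zero hq0 n.lt_succ_self]; simp
    rw [sum_range_succ', qDiffProd_succ', qPoch_succ' y, mul_div_mul_comm, ← ih hy']
    simp only [hrec]
    have hshift : ∑ k ∈ range (n + 1), u (k + 1) / q ^ (k + 1) * v (k + 1) + 1 =
        ∑ k ∈ range (n + 1), u k / q ^ k * v k := by
      have := sum_range_succ' (fun k => u k / q ^ k * v k) (n + 1)
      rw [sum_range_succ, hu0] at this
      simpa [hu, hv] using this.symm
    have : ∑ k ∈ range (n + 1), (u (k + 1) / q ^ (k + 1) - u k / q ^ k) * v (k + 1) + 1 =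
        ∑ k ∈ range (n + 1), (u k / q ^ k * v k - u k / q ^ k * v (k + 1)) := by
      rw [sum_sub_distrib, ← hshift]
      simp only [sub_mul, sum_sub_distrib]
      ring
    simp only [qPoch_zero, div_one, mul_one, pow_zero]
    rw [this, mul_sum]
    refine sum_congr rfl fun k _ => ?_
    have h1 : qPoch y q k ≠ 0 := qPoch_ne_zero hy k
    have h2 : 1 - y * q ^ k ≠ 0 := sub_ne_zero.2 (hy k).symm
    have h3 : qPoch (y * q) q k = qPoch y q k * (1 - y * q ^ k) / (1 - y) := by
      rw [eq_div_iff hy0, ← qPoch_succ, qPoch_succ', mul_comm]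
    have h4 := qPoch_self_ne_zero hq k
    rw [mul_comm y] at h2
    simp only [hu, hv]
    rw [h3, qPoch_succ, qPoch_succ, mul_comm y (q ^ k)]
    field_simp
    ring

/-- Pulling -q^l out of the l-th factor leaves the last k factors of (q; q)_{k+i}. This separates k
from i = j - k before sums are exchanged. -/
theorem qDiffProd_pow_add (hq : ‖q‖ < 1) (k i : ℕ) :
    qDiffProd (q ^ (k + i)) 1 q k / qPoch q q (k + i) =
      (-1) ^ k * q ^ k.choose 2 / qPoch q q i := by
  rw [div_eq_div_iff (qPoch_self_ne_zero hq _) (qPoch_self_ne_zero hq _)]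
  induction k generalizing i with
  | zero => simp
  | succ k ih =>
    have h := ih (i + 1)
    rw [qPoch_succ, show k + (i + 1) = k + 1 + i by ring] at h
    have hi : 1 - q * q ^ i ≠ 0 := sub_ne_zero.2 (mul_pow_ne_one hq i).symm
    apply mul_right_cancel₀ hi
    rw [qDiffProd_succ, choose_two_succ, pow_add q k]
    linear_combination (q ^ (k + 1 + i) - 1 * q ^ k) * h

/-- Pulling -c q^k out of the k-th factor leaves 1 - α q^{n-k}/c: the factors of (qα/c; q)_n in
reverse order. -/
theorem qDiffProd_reverse {c : ℂ} (hc : c ≠ 0) (n : ℕ) (α : ℂ) :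
    qDiffProd (α * q ^ n) c q n = (-c) ^ n * q ^ n.choose 2 * qPoch (q * α / c) q n := by
  induction n generalizing α with
  | zero => simp
  | succ n ih =>
    have h := ih (α * q)
    rw [mul_assoc, ← pow_succ'] at h
    rw [qDiffProd_succ, h, qPoch_succ', choose_two_succ,
      show q * (α * q) / c = q * α / c * q by ring]
    field_simp
    ring

/-- The transformation formula for a terminating `₃φ₂` series. -/
theorem sum_terminating_transformation (hq0 : q ≠ 0) (hq : ‖q‖ < 1) (n : ℕ) {α β c d : ℂ}
    (hc0 : c ≠ 0) (hc : ∀ k : ℕ, c * q ^ k ≠ 1) (hd : ∀ k : ℕ, d * q ^ k ≠ 1)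
    (he : ∀ k : ℕ, q * α / c * q ^ k ≠ 1) :
    ∑ j ∈ range (n + 1), qPoch (q ^ (-(n : ℤ))) q j * qPoch (α * q ^ n) q j * q ^ j *
        (qPoch β q j / (qPoch q q j * qPoch c q j * qPoch d q j)) =
      qPoch (q * α / c) q n * (-c) ^ n * q ^ n.choose 2 / qPoch c q n *
        ∑ k ∈ range (n + 1), qPoch (q ^ (-(n : ℤ))) q k * qPoch (α * q ^ n) q k *
          qDiffProd β d q k * (q / c) ^ k /
            (qPoch q q k * qPoch d q k * qPoch (q * α / c) q k) := by
  have hP := qPoch_self_ne_zero hq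
  set f : ℕ → ℕ → ℂ := fun k i =>
    qPoch (q ^ (-(n : ℤ))) q (k + i) * qPoch (α * q ^ n) q (k + i) * q ^ (k + i) /
      qPoch c q (k + i) * ((-1) ^ k * q ^ k.choose 2 / qPoch q q i) / qPoch q q k *
      (qDiffProd β d q k / qPoch d q k) with hf
  have hsplit : ∀ j, qPoch (q ^ (-(n : ℤ))) q j * qPoch (α * q ^ n) q j * q ^ j *
        (qPoch β q j / (qPoch q q j * qPoch c q j * qPoch d q j)) =
      ∑ k ∈ range (j + 1), f k (j - k) := by
    intro j
    calc _ = qPoch (q ^ (-(n : ℤ))) q j * qPoch (α * q ^ n) q j * q ^ j /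
          (qPoch q q j * qPoch c q j) * (qPoch β q j / qPoch d q j) := by ring
      _ = _ := by
        rw [← sum_qDiffProd_div hq j hd, mul_sum]
        refine sum_congr rfl fun k hk => ?_
        obtain ⟨i, rfl⟩ := Nat.exists_eq_add_of_le (Nat.lt_succ_iff.1 (mem_range.1 hk))
        simp only [hf, Nat.add_sub_cancel_left]
        rw [← qDiffProd_pow_add hq]
        ring
  simp only [hsplit]
  rw [sum_range_diag_flip, mul_sum]
  refine sum_congr rfl fun k hk => ?_
  obtain ⟨N, hN⟩ := Nat.exists_eq_add_of_le (Nat.lt_succ_iff.1 (mem_range.1 hk))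
  have hck : ∀ i : ℕ, c * q ^ k * q ^ i ≠ 1 := fun i => by
    rw [mul_assoc, ← pow_add]; exact hc _
  have hz : q ^ (-(n : ℤ)) * q ^ k = q ^ (-(N : ℤ)) := by
    rw [← zpow_natCast, ← zpow_add₀ hq0, hN]; congr 1; push_cast; ring
  -- After the exchange, the sum over i = j - k is a q-Chu–Vandermonde sum of length N = n - k with
  -- parameters α q^{n+k} and c q^k.
  have hsum := sum_qPoch_neg_zpow hq0 hq N (x := α * q ^ n * q ^ k) hck
  have hD : qDiffProd (α * q ^ n * q ^ k) (c * q ^ k) q N =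
      (q ^ k) ^ N * ((-c) ^ N * q ^ N.choose 2 * qPoch (q * α / c * q ^ k) q N) := by
    rw [qDiffProd_mul_mul, hN, pow_add, ← mul_assoc, qDiffProd_reverse hc0,
      show q * (α * q ^ k) / c = q * α / c * q ^ k by ring]
  rw [show n + 1 - k = N + 1 by omega]
  have hfk : ∀ i, f k i = qPoch (q ^ (-(n : ℤ))) q k * qPoch (α * q ^ n) q k * q ^ k *
      (-1) ^ k * q ^ k.choose 2 * qDiffProd β d q k /
        (qPoch q q k * qPoch c q k * qPoch d q k) *
      (qPoch (q ^ (-(N : ℤ))) q i * q ^ i / qPoch q q i *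
        (qPoch (α * q ^ n * q ^ k) q i / qPoch (c * q ^ k) q i)) := by
    intro i
    simp only [hf]
    rw [qPoch_add, hz, qPoch_add, qPoch_add c, pow_add q k i]
    ring
  simp only [hfk]
  rw [← mul_sum, hsum, hN, qPoch_add c, qPoch_add (q * α / c), choose_two_add, pow_add (-c)]
  have h1 : qPoch (c * q ^ k) q N ≠ 0 := qPoch_ne_zero hck N
  have h2 : qPoch c q k ≠ 0 := qPoch_ne_zero hc k
  have h3 : qPoch (q * α / c) q k ≠ 0 := qPoch_ne_zero he k
  have h4 : qPoch d q k ≠ 0 := qPoch_ne_zero hd k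
  have h5 := hP k
  rw [← hN, hD, div_pow]
  generalize qPoch (q ^ (-(n : ℤ))) q k = Z₁
  generalize qPoch (α * q ^ n) q k = Z₂
  generalize qPoch (c * q ^ k) q N = Z₃ at *
  generalize qPoch (q * α / c * q ^ k) q N = Z₄
  generalize qPoch (q * α / c) q k = Z₅ at *
  generalize qPoch c q k = Z₆ at *
  rw [neg_pow c k, pow_add q, pow_add q, pow_mul]
  field_simp

end Terminating

/-! ### Infinite products and norm bounds. -/

section Infinite

variable {q : ℂ}

theorem summable_norm_mul_pow (a : ℂ) (hq : ‖q‖ < 1) : Summable fun k : ℕ => ‖-(a * q ^ k)‖ := by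
  simp only [norm_neg, norm_mul, norm_pow]
  exact (summable_geometric_of_lt_one (norm_nonneg q) hq).mul_left _

theorem tendsto_qPoch (a : ℂ) (hq : ‖q‖ < 1) :
    Tendsto (fun n => qPoch a q n) atTop (𝓝 (qPochInf a q)) :=
  (multipliable_qPochInf a hq).tendsto_prod_tprod_nat

@[simp] theorem qPochInf_zero (q : ℂ) : qPochInf 0 q = 1 := by simp [qPochInf]

theorem qPoch_mul_qPochInf (a : ℂ) (hq : ‖q‖ < 1) (n : ℕ) :
    qPoch a q n * qPochInf (a * q ^ n) q = qPochInf a q := by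
  have h : ∀ k : ℕ, 1 - a * q ^ n * q ^ k = 1 - a * q ^ (k + n) := fun k => by ring
  have hm := multipliable_qPochInf (a * q ^ n) hq
  rw [funext h] at hm
  rw [qPochInf, tprod_congr h]
  exact Multipliable.prod_mul_tprod_nat_mul' (f := fun k : ℕ => 1 - a * q ^ k) hm

theorem qPochInf_step (a : ℂ) (hq : ‖q‖ < 1) :
    qPochInf a q = (1 - a) * qPochInf (a * q) q := by
  have := qPoch_mul_qPochInf a hq 1
  simpa [qPoch] using this.symm

theorem qPochInf_ne_zero {a : ℂ} (hq : ‖q‖ < 1) (h : ∀ k : ℕ, a * q ^ k ≠ 1) :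
    qPochInf a q ≠ 0 := by
  have := tprod_one_add_ne_zero_of_summable (f := fun k : ℕ => -(a * q ^ k))
    (fun k => by rw [← sub_eq_add_neg]; exact sub_ne_zero.2 (h k).symm)
    (summable_norm_mul_pow a hq)
  simpa [qPochInf, sub_eq_add_neg] using this

theorem norm_qPoch_sub_one_le (a : ℂ) (hq : ‖q‖ < 1) (n : ℕ) :
    ‖qPoch a q n - 1‖ ≤ Real.exp (‖a‖ / (1 - ‖q‖)) - 1 := by
  have h := (range n).norm_prod_one_add_sub_one_le (fun k => -(a * q ^ k))
  have h2 : ∑ k ∈ range n, ‖-(a * q ^ k)‖ ≤ ‖a‖ / (1 - ‖q‖) := by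
    refine ((summable_norm_mul_pow a hq).sum_le_tsum _ fun _ _ => norm_nonneg _).trans_eq ?_
    simp only [norm_neg, norm_mul, norm_pow]
    rw [tsum_mul_left, tsum_geometric_of_lt_one (norm_nonneg q) hq, div_eq_mul_inv]
  simp only [← sub_eq_add_neg] at h
  exact h.trans (sub_le_sub_right (Real.exp_le_exp.2 h2) 1)

theorem norm_qPochInf_sub_one_le (a : ℂ) (hq : ‖q‖ < 1) :
    ‖qPochInf a q - 1‖ ≤ Real.exp (‖a‖ / (1 - ‖q‖)) - 1 :=
  le_of_tendsto ((tendsto_qPoch a hq).sub_const 1).norm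
    (Eventually.of_forall (norm_qPoch_sub_one_le a hq))

theorem norm_qPoch_le {a : ℂ} {B : ℝ} (hq : ‖q‖ < 1) (ha : ‖a‖ ≤ B) (n : ℕ) :
    ‖qPoch a q n‖ ≤ Real.exp (B / (1 - ‖q‖)) := by
  have h1 := norm_qPoch_sub_one_le a hq n
  have h2 : Real.exp (‖a‖ / (1 - ‖q‖)) ≤ Real.exp (B / (1 - ‖q‖)) := by
    have : 0 < 1 - ‖q‖ := by linarith
    gcongr
  have h3 := norm_sub_norm_le (qPoch a q n) 1
  rw [norm_one] at h3
  linarith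

theorem norm_qPochInf_le {a : ℂ} {B : ℝ} (hq : ‖q‖ < 1) (ha : ‖a‖ ≤ B) :
    ‖qPochInf a q‖ ≤ Real.exp (B / (1 - ‖q‖)) :=
  le_of_tendsto (tendsto_qPoch a hq).norm (Eventually.of_forall (norm_qPoch_le hq ha))

theorem tendsto_qPochInf_mul_pow (a : ℂ) (hq : ‖q‖ < 1) :
    Tendsto (fun N : ℕ => qPochInf (a * q ^ N) q) atTop (𝓝 1) := by
  rw [tendsto_iff_norm_sub_tendsto_zero]
  refine squeeze_zero (fun _ => norm_nonneg _) (fun N => norm_qPochInf_sub_one_le _ hq) ?_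
  have h : Tendsto (fun N : ℕ => ‖a * q ^ N‖ / (1 - ‖q‖)) atTop (𝓝 0) := by
    have := ((tendsto_pow_atTop_nhds_zero_of_norm_lt_one hq).const_mul a).norm.div_const (1 - ‖q‖)
    simpa using this
  have := ((Real.continuous_exp.tendsto 0).comp h).sub_const 1
  simpa using this

theorem summable_pow_mul_pow_choose_two {K r : ℝ} (hK : 0 ≤ K) (hr0 : 0 ≤ r) (hr1 : r < 1) :
    Summable fun m : ℕ => K ^ m * r ^ m.choose 2 := by
  refine summable_of_ratio_norm_eventually_le (r := 1 / 2) (by norm_num) ?_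
  have h : Tendsto (fun m : ℕ => K * r ^ m) atTop (𝓝 0) := by
    simpa using (tendsto_pow_atTop_nhds_zero_of_lt_one hr0 hr1).const_mul K
  filter_upwards [h.eventually (ge_mem_nhds (by norm_num : (0 : ℝ) < 1 / 2))] with m hm
  rw [Real.norm_of_nonneg (by positivity), Real.norm_of_nonneg (by positivity), choose_two_succ,
    pow_succ, pow_add]
  calc K ^ m * K * (r ^ m * r ^ m.choose 2) = (K * r ^ m) * (K ^ m * r ^ m.choose 2) := by ring
    _ ≤ _ := by gcongr

theorem norm_qDiffProd_le {x y : ℂ} {R : ℝ} (hq : ‖q‖ < 1) (hx : ‖x‖ ≤ R) (hy : ‖y‖ ≤ 1)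
    (n : ℕ) : ‖qDiffProd x y q n‖ ≤ (R + 1) ^ n := by
  rw [qDiffProd, norm_prod]
  refine (prod_le_prod (fun _ _ => norm_nonneg _) fun k _ => ?_).trans_eq (by
    rw [prod_const, card_range])
  calc ‖x - y * q ^ k‖ ≤ ‖x‖ + ‖y * q ^ k‖ := norm_sub_le _ _
    _ ≤ R + 1 * 1 := by
      rw [norm_mul, norm_pow]
      gcongr
      exact pow_le_one₀ (norm_nonneg _) hq.le
    _ = R + 1 := by ring

theorem norm_inv_qPoch_self_le (hq : ‖q‖ < 1) (n : ℕ) :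
    ‖(qPoch q q n)⁻¹‖ ≤ ((1 - ‖q‖)⁻¹) ^ n := by
  have h0 : 0 < 1 - ‖q‖ := by linarith
  rw [norm_inv, inv_pow]
  refine inv_anti₀ (by positivity) ?_
  rw [qPoch, norm_prod, ← card_range n, ← prod_const, card_range]
  refine prod_le_prod (fun _ _ => h0.le) fun k _ => ?_
  have h1 := norm_sub_norm_le 1 (q * q ^ k)
  rw [norm_one, norm_mul, norm_pow] at h1
  have h2 : ‖q‖ * ‖q‖ ^ k ≤ ‖q‖ * 1 := by
    gcongr; exact pow_le_one₀ (norm_nonneg _) hq.le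
  linarith

end Infinite

/-! ### The confluent very-well-poised sum. -/

section VeryWellPoised

/-- The very-well-poised factor `(1 - A q^{2m}) (A; q)_m / (1 - A)`, written so that it makes
sense for `A = 1`. -/
def vwpFactor (A q : ℂ) : ℕ → ℂ
  | 0 => 1
  | m + 1 => (1 - A * q ^ (2 * (m + 1))) * qPoch (A * q) q m

/-- The rapidly decreasing part of the terms of the very-well-poised series. -/
noncomputable def vwpCore (α q s a b : ℂ) (m : ℕ) : ℂ :=
  (qPoch q q m)⁻¹ * qDiffProd a (s * q) q m * qDiffProd b (s * q) q m * (-1) ^ m *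
    q ^ m.choose 2 * (α / q) ^ m

/-- The term of the very-well-poised series with base parameter `α s²`, with the infinite
products cleared from its denominators. -/
noncomputable def vwpTerm (α q s a b : ℂ) (m : ℕ) : ℂ :=
  vwpFactor (α * s ^ 2) q m * vwpCore α q s a b m *
    (qPochInf (α * s * a * q ^ m) q * qPochInf (α * s * b * q ^ m) q)

variable {q : ℂ}

theorem norm_vwpCore_le {α s a b : ℂ} {R : ℝ} (hq : ‖q‖ < 1) (hs : ‖s‖ ≤ 1) (ha : ‖a‖ ≤ R)
    (hb : ‖b‖ ≤ R) (m : ℕ) :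
    ‖vwpCore α q s a b m‖ ≤
      ((1 - ‖q‖)⁻¹ * (R + 1) * (R + 1) * ‖α / q‖) ^ m * ‖q‖ ^ m.choose 2 := by
  have h0 : 0 < 1 - ‖q‖ := by linarith
  have hR : 0 ≤ R := (norm_nonneg a).trans ha
  have hsq : ‖s * q‖ ≤ 1 := by
    rw [norm_mul]; exact mul_le_one₀ hs (norm_nonneg _) hq.le
  simp only [vwpCore, norm_mul, norm_pow, norm_neg, norm_one, one_pow, mul_one, mul_pow]
  calc _ ≤ (1 - ‖q‖)⁻¹ ^ m * (R + 1) ^ m * (R + 1) ^ m * ‖q‖ ^ m.choose 2 * ‖α / q‖ ^ m := by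
        gcongr
        · exact norm_inv_qPoch_self_le hq m
        · exact norm_qDiffProd_le hq ha hsq m
        · exact norm_qDiffProd_le hq hb hsq m
    _ = _ := by ring

theorem norm_vwpFactor_le {A : ℂ} {B : ℝ} (hq : ‖q‖ < 1) (hA : ‖A‖ ≤ B) (m : ℕ) :
    ‖vwpFactor A q m‖ ≤ (1 + B) * Real.exp (B / (1 - ‖q‖)) := by
  have h0 : 0 < 1 - ‖q‖ := by linarith
  have hB : 0 ≤ B := (norm_nonneg A).trans hA
  cases m with
  | zero =>
    have : 1 ≤ Real.exp (B / (1 - ‖q‖)) := Real.one_le_exp (by positivity)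
    simp only [vwpFactor, norm_one]
    nlinarith
  | succ m =>
    have hAq : ‖A * q‖ ≤ B := by
      rw [norm_mul]; nlinarith [norm_nonneg A, norm_nonneg q]
    rw [vwpFactor, norm_mul]
    gcongr
    · refine (norm_sub_le _ _).trans ?_
      rw [norm_one, norm_mul, norm_pow]
      have : ‖q‖ ^ (2 * (m + 1)) ≤ 1 := pow_le_one₀ (norm_nonneg _) hq.le
      nlinarith [norm_nonneg A]
    · exact norm_qPoch_le hq hAq m

theorem norm_mul_mul_pow_le {α s a : ℂ} {R : ℝ} (hq : ‖q‖ < 1) (hs : ‖s‖ ≤ 1) (ha : ‖a‖ ≤ R)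
    (m : ℕ) : ‖α * s * a * q ^ m‖ ≤ ‖α‖ * R := by
  have hR : 0 ≤ R := (norm_nonneg a).trans ha
  rw [norm_mul, norm_mul, norm_mul, norm_pow]
  calc _ ≤ ‖α‖ * 1 * R * 1 := by
        gcongr
        exact pow_le_one₀ (norm_nonneg _) hq.le
    _ = _ := by ring

/-- A bound for the terms of the very-well-poised series, uniform in all parameters but `α`. -/
theorem norm_vwpTerm_le {α s a b : ℂ} {R : ℝ} (hq : ‖q‖ < 1) (hs : ‖s‖ ≤ 1) (ha : ‖a‖ ≤ R)
    (hb : ‖b‖ ≤ R) (m : ℕ) :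
    ‖vwpTerm α q s a b m‖ ≤
      (1 + ‖α‖) * Real.exp (‖α‖ / (1 - ‖q‖)) *
        (((1 - ‖q‖)⁻¹ * (R + 1) * (R + 1) * ‖α / q‖) ^ m * ‖q‖ ^ m.choose 2) *
        (Real.exp (‖α‖ * R / (1 - ‖q‖)) * Real.exp (‖α‖ * R / (1 - ‖q‖))) := by
  have h0 : 0 < 1 - ‖q‖ := by linarith
  have hR : 0 ≤ R := (norm_nonneg a).trans ha
  have hA : ‖α * s ^ 2‖ ≤ ‖α‖ := by
    rw [norm_mul, norm_pow]
    exact mul_le_of_le_one_right (norm_nonneg _) (pow_le_one₀ (norm_nonneg _) hs)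
  rw [vwpTerm, norm_mul, norm_mul, norm_mul]
  gcongr
  · exact norm_vwpFactor_le hq hA m
  · exact norm_vwpCore_le hq hs ha hb m
  · exact norm_qPochInf_le hq (norm_mul_mul_pow_le hq hs ha m)
  · exact norm_qPochInf_le hq (norm_mul_mul_pow_le hq hs hb m)

theorem summable_vwp_bound (α : ℂ) {R : ℝ} (hq : ‖q‖ < 1) (hR : 0 ≤ R) :
    Summable fun m : ℕ => (1 + ‖α‖) * Real.exp (‖α‖ / (1 - ‖q‖)) *
        (((1 - ‖q‖)⁻¹ * (R + 1) * (R + 1) * ‖α / q‖) ^ m * ‖q‖ ^ m.choose 2) *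
        (Real.exp (‖α‖ * R / (1 - ‖q‖)) * Real.exp (‖α‖ * R / (1 - ‖q‖))) := by
  have h0 : 0 < 1 - ‖q‖ := by linarith
  exact ((summable_pow_mul_pow_choose_two (by positivity) (norm_nonneg q) hq).mul_left _).mul_right _

theorem summable_vwpTerm {α s : ℂ} (hq : ‖q‖ < 1) (hs : ‖s‖ ≤ 1) (a b : ℂ) :
    Summable (vwpTerm α q s a b) :=
  .of_norm_bounded (summable_vwp_bound α (R := max ‖a‖ ‖b‖) hq (by positivity))
    (norm_vwpTerm_le hq hs (le_max_left _ _) (le_max_right _ _))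

/-- The expected value contains (αab/q; q)_∞, which loses the factor 1 - αab/q when a becomes aq.
The corresponding difference of terms telescopes, and the right-hand side is its partial sum in
closed form. -/
theorem sum_vwpTerm_sub (hq0 : q ≠ 0) (hq : ‖q‖ < 1) (α s a b : ℂ) (n : ℕ) :
    ∑ m ∈ range (n + 1),
        (vwpTerm α q s a b m - (1 - α * a * b / q) * vwpTerm α q s (a * q) b m) =
      a * (α / q) * q ^ n * qPoch (α * s ^ 2 * q) q n * (b - s * q * q ^ n) *
        vwpCore α q s a b n *
        (qPochInf (α * s * a * q ^ (n + 1)) q * qPochInf (α * s * b * q ^ n) q) := by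
  induction n with
  | zero =>
    have h1 := qPochInf_step (α * s * a) hq
    simp [vwpTerm, vwpCore, vwpFactor, h1]
    field_simp
    ring
  | succ n ih =>
    rw [sum_range_succ, ih]
    -- Peeling off these factors leaves the same two infinite products in every term.
    have h1 := qPochInf_step (α * s * a * q ^ (n + 1)) hq
    have h2 := qPochInf_step (α * s * b * q ^ n) hq
    have h3 : 1 - q * q ^ n ≠ 0 := sub_ne_zero.2 (mul_pow_ne_one hq n).symm
    have h4 := qPoch_self_ne_zero hq n
    have h5 : qDiffProd (a * q) (s * q) q (n + 1) =
        q ^ (n + 1) * ((a - s) * qDiffProd a (s * q) q n) := by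
      rw [qDiffProd_mul_mul, qDiffProd_succ']
    rw [mul_assoc _ _ q, ← pow_succ] at h1 h2
    simp only [vwpTerm, vwpCore, vwpFactor]
    rw [h5, show α * s * (a * q) * q ^ (n + 1) = α * s * a * q ^ (n + 1 + 1) by ring, h1, h2,
      qPoch_succ, qPoch_succ, qDiffProd_succ, qDiffProd_succ, choose_two_succ]
    generalize qPochInf (α * s * a * q ^ (n + 1 + 1)) q = I₁
    generalize qPochInf (α * s * b * q ^ (n + 1)) q = I₂
    generalize qPoch q q n = Z₁ at *
    generalize qPoch (α * s ^ 2 * q) q n = Z₂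
    generalize qDiffProd a (s * q) q n = Z₃
    generalize qDiffProd b (s * q) q n = Z₄
    rw [mul_inv, pow_add q n (n.choose 2), pow_succ (-1 : ℂ), pow_succ (α / q),
      show q ^ (2 * (n + 1)) = q ^ n * q ^ n * q ^ 2 by ring, pow_succ q n]
    generalize q ^ n.choose 2 = T
    generalize (α / q) ^ n = S
    generalize (-1 : ℂ) ^ n = S'
    generalize q ^ n = Q at *
    field_simp
    ring

theorem tendsto_vwpCore {s : ℂ} (hq : ‖q‖ < 1) (hs : ‖s‖ ≤ 1) (α a b : ℂ) :
    Tendsto (vwpCore α q s a b) atTop (𝓝 0) := by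
  have h0 : 0 < 1 - ‖q‖ := by linarith
  exact squeeze_zero_norm (norm_vwpCore_le hq hs (le_max_left ‖a‖ ‖b‖) (le_max_right _ _))
    (summable_pow_mul_pow_choose_two (by positivity) (norm_nonneg q) hq).tendsto_atTop_zero

/-- The closed form of `sum_vwpTerm_sub` tends to 0: q^n and `vwpCore` do, and the other factors
converge. -/
theorem tsum_vwpTerm_step {s : ℂ} (hq0 : q ≠ 0) (hq : ‖q‖ < 1) (hs : ‖s‖ ≤ 1) (α a b : ℂ) :
    ∑' m, vwpTerm α q s a b m = (1 - α * a * b / q) * ∑' m, vwpTerm α q s (a * q) b m := by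
  have h1 := summable_vwpTerm (α := α) hq hs a b
  have h2 := (summable_vwpTerm (α := α) hq hs (a * q) b).mul_left (1 - α * a * b / q)
  rw [← sub_eq_zero, ← tsum_mul_left, ← h1.tsum_sub h2]
  refine tendsto_nhds_unique
    ((h1.sub h2).hasSum.tendsto_sum_nat.comp (tendsto_add_atTop_nat 1)) ?_
  have e : ((fun n => ∑ i ∈ range n, (vwpTerm α q s a b i -
      (1 - α * a * b / q) * vwpTerm α q s (a * q) b i)) ∘ fun n => n + 1) =
      fun n => a * (α / q) * q ^ n * qPoch (α * s ^ 2 * q) q n * (b - s * q * q ^ n) *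
        vwpCore α q s a b n *
        (qPochInf (α * s * a * q ^ (n + 1)) q * qPochInf (α * s * b * q ^ n) q) :=
    funext fun n => sum_vwpTerm_sub hq0 hq α s a b n
  rw [e]
  have hqn := tendsto_pow_atTop_nhds_zero_of_norm_lt_one hq
  have := (((((hqn.const_mul (a * (α / q))).mul (tendsto_qPoch (α * s ^ 2 * q) hq)).mul
    ((hqn.const_mul (s * q)).const_sub b)).mul (tendsto_vwpCore hq hs α a b)).mul
    (((tendsto_qPochInf_mul_pow (α * s * a) hq).comp (tendsto_add_atTop_nat 1)).mul
      (tendsto_qPochInf_mul_pow (α * s * b) hq)))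
  simpa using this

theorem tsum_vwpTerm_iterate {s : ℂ} (hq0 : q ≠ 0) (hq : ‖q‖ < 1) (hs : ‖s‖ ≤ 1) (α a b : ℂ)
    (N : ℕ) : ∑' m, vwpTerm α q s a b m =
      qPoch (α * a * b / q) q N * ∑' m, vwpTerm α q s (a * q ^ N) b m := by
  induction N with
  | zero => simp
  | succ N ih =>
    rw [ih, tsum_vwpTerm_step hq0 hq hs, qPoch_succ, pow_succ, ← mul_assoc a,
      show α * (a * q ^ N) * b / q = α * a * b / q * q ^ N by ring]
    ring

theorem tendsto_tsum_vwpTerm {s : ℂ} (hq : ‖q‖ < 1) (hs : ‖s‖ ≤ 1) (α a b : ℂ) :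
    Tendsto (fun N : ℕ => ∑' m, vwpTerm α q s (a * q ^ N) b m) atTop
      (𝓝 (∑' m, vwpTerm α q s 0 b m)) := by
  refine tendsto_tsum_of_dominated_convergence
    (summable_vwp_bound α (R := max ‖a‖ ‖b‖) hq (by positivity)) (fun m => ?_)
    (Eventually.of_forall fun N m => norm_vwpTerm_le hq hs ?_ (le_max_right _ _) m)
  · have h1 : Tendsto (fun N : ℕ => a * q ^ N) atTop (𝓝 0) := by
      simpa using (tendsto_pow_atTop_nhds_zero_of_norm_lt_one hq).const_mul a
    have h2 : Tendsto (fun N : ℕ => qDiffProd (a * q ^ N) (s * q) q m) atTop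
        (𝓝 (qDiffProd 0 (s * q) q m)) :=
      tendsto_finsetProd _ fun k _ => h1.sub_const _
    have h3 : Tendsto (fun N : ℕ => qPochInf (α * s * (a * q ^ N) * q ^ m) q) atTop
        (𝓝 (qPochInf (α * s * 0 * q ^ m) q)) := by
      have := tendsto_qPochInf_mul_pow (α * s * a * q ^ m) hq
      simp only [mul_zero, zero_mul, qPochInf_zero]
      exact this.congr fun N => by ring_nf
    exact (((((h2.const_mul _).mul_const _).mul_const _).mul_const _).mul_const _).const_mul _ |>.mul
      (h3.mul_const _)
  · rw [norm_mul, norm_pow]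
    exact (mul_le_of_le_one_right (norm_nonneg _) (pow_le_one₀ (norm_nonneg _) hq.le)).trans
      (le_max_left _ _)

/-- Summation of the very-well-poised series, a confluent case of the nonterminating `₆φ₅` sum. -/
theorem tsum_vwpTerm {α s b : ℂ} (hq0 : q ≠ 0) (hq : ‖q‖ < 1) (hs : ‖s‖ ≤ 1)
    (hb : ∀ k : ℕ, α * s * b * q ^ k ≠ 1) (a : ℂ) :
    ∑' m, vwpTerm α q s a b m = qPochInf (α * s ^ 2 * q) q * qPochInf (α * a * b / q) q := by
  have key : ∀ a, ∑' m, vwpTerm α q s a b m =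
      qPochInf (α * a * b / q) q * ∑' m, vwpTerm α q s 0 b m := fun a =>
    tendsto_nhds_unique tendsto_const_nhds
      (((tendsto_qPoch (α * a * b / q) hq).mul (tendsto_tsum_vwpTerm hq hs α a b)).congr
        fun N => (tsum_vwpTerm_iterate hq0 hq hs α a b N).symm)
  -- At a = sq every term with m ≥ 1 contains the factor a - sq = 0. Comparison with `key` at this a
  -- determines the sum at a = 0, since (αsb; q)_∞ ≠ 0 by `hb`.
  have h1 : ∑' m, vwpTerm α q s (s * q) b m =
      qPochInf (α * s ^ 2 * q) q * qPochInf (α * s * b) q := by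
    rw [tsum_eq_single 0]
    · simp [vwpTerm, vwpFactor, vwpCore]
      left; congr 1; ring
    · intro m hm
      obtain ⟨k, rfl⟩ := Nat.exists_eq_succ_of_ne_zero hm
      simp [vwpTerm, vwpCore, qDiffProd_succ']
  have h2 := key (s * q)
  rw [h1, show α * (s * q) * b / q = α * s * b by field_simp, mul_comm] at h2
  rw [key a, ← mul_left_cancel₀ (qPochInf_ne_zero hq hb) h2, mul_comm]

end VeryWellPoised

/-! ### The double series and its two summations. -/

section Transformation

variable {q : ℂ}

/-- The term of the `₃φ₂` series on the left-hand side, polynomial in `a` and `b`. -/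
noncomputable def phiTerm (α a b c d β q : ℂ) (n : ℕ) : ℂ :=
  qPochDivMulPow a q n * qPochDivMulPow b q n * qPoch β q n /
    (qPoch q q n * qPoch c q n * qPoch d q n) * (α / q) ^ n

theorem phiTerm_succ (α a b c d β q : ℂ) (n : ℕ) :
    phiTerm α a b c d β q (n + 1) = (a - q * q ^ n) * (b - q * q ^ n) * (1 - β * q ^ n) /
      ((1 - q * q ^ n) * (1 - c * q ^ n) * (1 - d * q ^ n)) * (α / q) *
      phiTerm α a b c d β q n := by
  simp only [phiTerm, qPochDivMulPow_eq_qDiffProd, qDiffProd_succ, qPoch_succ,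
    pow_succ, div_eq_mul_inv, mul_inv]
  ring

theorem summable_phiTerm (hq : ‖q‖ < 1) {α a b : ℂ} (c d β : ℂ) (h : ‖α * a * b / q‖ < 1) :
    Summable (phiTerm α a b c d β q) := by
  obtain ⟨r, hr, hr1⟩ := exists_between h
  refine summable_of_ratio_norm_eventually_le hr1 ?_
  have hqn := tendsto_pow_atTop_nhds_zero_of_norm_lt_one hq
  have hl : ∀ x y : ℂ, Tendsto (fun n => x - y * q ^ n) atTop (𝓝 x) := fun x y => by
    simpa using (hqn.const_mul y).const_sub x
  have ht := (((((hl a q).mul (hl b q)).mul (hl 1 β)).div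
    (((hl 1 q).mul (hl 1 c)).mul (hl 1 d)) (by simp)).mul_const (α / q)).norm
  have e : a * b * 1 / (1 * 1 * 1) * (α / q) = α * a * b / q := by ring
  rw [e] at ht
  filter_upwards [ht.eventually (gt_mem_nhds hr)] with n hn
  rw [phiTerm_succ, norm_mul]
  gcongr
  exact hn.le

/-- Both sides equal (1 - α q^{2(j+m)}) (α; q)_{2j+m}. -/
theorem qPoch_mul_vwpFactor (α : ℂ) (j m : ℕ) :
    (1 - α) * (qPoch (α * q) q (2 * j) * vwpFactor (α * (q ^ j) ^ 2) q m) =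
      (1 - α * q ^ (2 * (j + m))) * (qPoch α q (j + m) * qPoch (α * q ^ (j + m)) q j) := by
  rw [← qPoch_add, ← pow_mul]
  cases m with
  | zero =>
    rw [vwpFactor, mul_one, ← qPoch_succ', qPoch_succ, add_zero, two_mul]
    ring
  | succ m =>
    rw [vwpFactor, show j + (m + 1) + j = 2 * j + m + 1 by ring, qPoch_succ', qPoch_add,
      show α * q * q ^ (2 * j) = α * q ^ (j * 2) * q by ring]
    ring

theorem qPoch_neg_zpow_div (hq0 : q ≠ 0) (hq : ‖q‖ < 1) (j m : ℕ) :
    qPoch (q ^ (-((j + m : ℕ) : ℤ))) q j / qPoch q q (j + m) * (q ^ (j + m)) ^ j =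
      (-1) ^ j * q ^ j.choose 2 / qPoch q q m := by
  rw [← qDiffProd_pow_add hq, div_mul_eq_mul_div, mul_comm]
  have := qDiffProd_mul_mul 1 (q ^ (-((j + m : ℕ) : ℤ))) (q ^ (j + m)) q j
  rw [one_mul, qDiffProd_one_left, zpow_neg, zpow_natCast,
    inv_mul_cancel₀ (pow_ne_zero _ hq0)] at this
  rw [this, zpow_neg, zpow_natCast]

theorem choose_two_mul_two_add (n : ℕ) : n.choose 2 + n.choose 2 + n = n * n := by
  induction n with
  | zero => rfl
  | succ n ih => rw [choose_two_succ]; linarith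

/-- With n = j + m, factorials of lengths j and m merge into factorials of length n. What remains is
the j-th term of a terminating series; its (q^{-n}; q)_j arises from writing 1/(q; q)_m over (q;
q)_n. -/
theorem phiTerm_mul_vwpTerm (hq0 : q ≠ 0) (hq : ‖q‖ < 1) {α a b : ℂ} (c d β : ℂ) (hα : α ≠ 1)
    (ha : ∀ k : ℕ, α * a * q ^ k ≠ 1) (hb : ∀ k : ℕ, α * b * q ^ k ≠ 1) (j m : ℕ) :
    phiTerm α a b c d β q j * (qPoch (α * q) q (2 * j) * vwpTerm α q (q ^ j) a b m) =
      qPochInf (α * a) q * qPochInf (α * b) q *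
        ((1 - α * q ^ (2 * (j + m))) *
          (qPoch α q (j + m) * qPochDivMulPow a q (j + m) * qPochDivMulPow b q (j + m)) *
          ((α / q) ^ (j + m) * (-1) ^ (j + m) * q ^ (j + m).choose 2) /
        ((1 - α) * (qPoch q q (j + m) * qPoch (α * a) q (j + m) * qPoch (α * b) q (j + m)))) *
        (qPoch (q ^ (-((j + m : ℕ) : ℤ))) q j * qPoch (α * q ^ (j + m)) q j * q ^ j *
          (qPoch β q j / (qPoch q q j * qPoch c q j * qPoch d q j))) := by
  have h1 : 1 - α ≠ 0 := sub_ne_zero.2 hα.symm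
  have h2 := qPoch_mul_vwpFactor (q := q) α j m
  have h3 := qPoch_neg_zpow_div hq0 hq j m
  have h4 := qPoch_mul_qPochInf (α * a) hq (j + m)
  have h5 := qPoch_mul_qPochInf (α * b) hq (j + m)
  have h6 : qPoch (α * a) q (j + m) ≠ 0 := qPoch_ne_zero ha _
  have h7 : qPoch (α * b) q (j + m) ≠ 0 := qPoch_ne_zero hb _
  have h8 : qPoch (α * q) q (2 * j) * vwpFactor (α * (q ^ j) ^ 2) q m =
      (1 - α * q ^ (2 * (j + m))) * (qPoch α q (j + m) * qPoch (α * q ^ (j + m)) q j) /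
        (1 - α) := by rw [← h2]; field_simp
  have h9 : (q ^ (j + m)) ^ j ≠ 0 := pow_ne_zero _ (pow_ne_zero _ hq0)
  have h10 : qPoch (q ^ (-((j + m : ℕ) : ℤ))) q j =
      (-1) ^ j * q ^ j.choose 2 / qPoch q q m / (q ^ (j + m)) ^ j * qPoch q q (j + m) := by
    rw [← h3]; field_simp [qPoch_self_ne_zero hq (j + m)]
  have h11 : q ^ (j + m).choose 2 * q ^ j.choose 2 * q ^ j = q ^ m.choose 2 * (q ^ (j + m)) ^ j := by
    rw [← pow_mul, ← pow_add, ← pow_add, ← pow_add]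
    congr 1
    have := choose_two_mul_two_add j
    rw [choose_two_add]
    linarith
  have h12 : (-1 : ℂ) ^ (j + m) * (-1) ^ j = (-1) ^ m := by
    rw [← pow_add, show j + m + j = m + 2 * j by ring, pow_add, pow_mul]; simp
  have hm := qPoch_self_ne_zero hq m
  have hn := qPoch_self_ne_zero hq (j + m)
  rw [vwpTerm, ← mul_assoc (qPoch (α * q) q (2 * j)), ← mul_assoc (qPoch (α * q) q (2 * j)), h8,
    h10, ← h4, ← h5]
  simp only [phiTerm, vwpCore, qPochDivMulPow_eq_qDiffProd, mul_div_assoc]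
  rw [qDiffProd_add a, qDiffProd_add b, ← h12, mul_comm q (q ^ j),
    show α * q ^ j * a * q ^ m = α * a * q ^ (j + m) by ring,
    show α * q ^ j * b * q ^ m = α * b * q ^ (j + m) by ring]
  have h13 : q ^ m.choose 2 =
      q ^ (j + m).choose 2 * q ^ j.choose 2 * q ^ j / (q ^ (j + m)) ^ j := by
    rw [h11]; field_simp
  rw [h13, pow_add (α / q)]
  clear h2 h3 h4 h5 h8 h10 h11 h12 h13
  generalize qPochInf (α * a * q ^ (j + m)) q = I₁
  generalize qPochInf (α * b * q ^ (j + m)) q = I₂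
  generalize qPoch (α * a) q (j + m) = Z₁ at *
  generalize qPoch (α * b) q (j + m) = Z₂ at *
  generalize qPoch (α * q ^ (j + m)) q j = Z₃ at *
  generalize 1 - α * q ^ (2 * (j + m)) = Z₄
  generalize (q ^ (j + m)) ^ j = Z₅ at *
  generalize 1 - α = A at *
  generalize (α / q) ^ j = S
  generalize (α / q) ^ m = S'
  generalize (-1 : ℂ) ^ (j + m) = ε
  generalize (-1 : ℂ) ^ j = ε'
  generalize qPoch q q m = Y₁ at *
  generalize qPoch q q (j + m) = Y₂ at *
  generalize qPoch q q j = Y₃ at *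
  generalize qPoch α q (j + m) = Y₄
  generalize q ^ (j + m).choose 2 = Y₅
  generalize q ^ j.choose 2 = Y₆
  have h14 : Z₁ * Z₂ * Y₂ * (A * (Y₂ * Z₁ * Z₂))⁻¹ = A⁻¹ := by
    field_simp
  generalize qPoch β q j / (Y₃ * qPoch c q j * qPoch d q j) = W
  simp only [div_eq_mul_inv]
  generalize (A * (Y₂ * Z₁ * Z₂))⁻¹ = V at *
  generalize A⁻¹ = A' at *
  rw [← h14]
  ring

/-- The right-hand side summand, with the terminating series written as a finite sum that is
polynomial in `β`. -/
noncomputable def rhsTerm (α a b c d β q : ℂ) (n : ℕ) : ℂ :=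
  (1 - α * q ^ (2 * n)) *
      (qPoch α q n * qPochDivMulPow a q n * qPochDivMulPow b q n * qPoch (q * α / c) q n) *
      (α * c) ^ n * q ^ ((n : ℤ) ^ 2 - 2 * (n : ℤ)) /
    ((1 - α) * (qPoch q q n * qPoch (α * a) q n * qPoch (α * b) q n * qPoch c q n)) *
  ∑ k ∈ range (n + 1), qPoch (q ^ (-(n : ℤ))) q k * qPoch (α * q ^ n) q k *
    qDiffProd β d q k * (q / c) ^ k / (qPoch q q k * qPoch d q k * qPoch (q * α / c) q k)

theorem sum_phiTerm_mul_vwpTerm (hq0 : q ≠ 0) (hq : ‖q‖ < 1) {α a b c d : ℂ} (β : ℂ)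
    (hc0 : c ≠ 0) (hα : α ≠ 1)
    (ha : ∀ k : ℕ, α * a * q ^ k ≠ 1) (hb : ∀ k : ℕ, α * b * q ^ k ≠ 1)
    (hc : ∀ k : ℕ, c * q ^ k ≠ 1) (hd : ∀ k : ℕ, d * q ^ k ≠ 1)
    (he : ∀ k : ℕ, q * α / c * q ^ k ≠ 1) (n : ℕ) :
    ∑ p ∈ antidiagonal n, phiTerm α a b c d β q p.1 *
        (qPoch (α * q) q (2 * p.1) * vwpTerm α q (q ^ p.1) a b p.2) =
      qPochInf (α * a) q * qPochInf (α * b) q * rhsTerm α a b c d β q n := by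
  have h := sum_terminating_transformation hq0 hq n (β := β) hc0 hc hd he
  -- One q^{n(n-1)/2} comes from the very-well-poised terms, the other from the terminating
  -- transformation. Each also brings a sign (-1)^n, and `hs` cancels these.
  have hz : q ^ ((n : ℤ) ^ 2 - 2 * (n : ℤ)) = q ^ n.choose 2 * q ^ n.choose 2 / q ^ n := by
    rw [eq_div_iff (pow_ne_zero _ hq0), ← zpow_natCast q n, ← zpow_add₀ hq0, ← pow_add,
      ← zpow_natCast]
    congr 1
    have := choose_two_mul_two_add n
    zify at this
    push_cast
    linarith
  rw [sum_congr rfl fun p hp => by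
    rw [phiTerm_mul_vwpTerm hq0 hq c d β hα ha hb p.1 p.2, mem_antidiagonal.1 hp]]
  rw [← mul_sum, Nat.sum_antidiagonal_eq_sum_range_succ_mk, h, rhsTerm, hz, neg_pow c,
    div_pow, mul_pow α c]
  have hs : (-1 : ℂ) ^ n * (-1) ^ n = 1 := by rw [← mul_pow]; simp
  generalize 1 - α = A
  linear_combination (qPochInf (α * a) q * qPochInf (α * b) q *
        ((1 - α * q ^ (2 * n)) *
          (qPoch α q n * qPochDivMulPow a q n * qPochDivMulPow b q n) *
          (α ^ n / q ^ n * q ^ n.choose 2) /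
        (A * (qPoch q q n * qPoch (α * a) q n * qPoch (α * b) q n))) *
    (qPoch (q * α / c) q n * c ^ n * q ^ n.choose 2 / qPoch c q n *
        ∑ k ∈ range (n + 1), qPoch (q ^ (-(n : ℤ))) q k * qPoch (α * q ^ n) q k *
          qDiffProd β d q k * (q / c) ^ k /
            (qPoch q q k * qPoch d q k * qPoch (q * α / c) q k))) * hs

theorem hasSum_rhsTerm (hq0 : q ≠ 0) (hq : ‖q‖ < 1) {α a b c d : ℂ} (β : ℂ)
    (hc0 : c ≠ 0) (hα : α ≠ 1)
    (ha : ∀ k : ℕ, α * a * q ^ k ≠ 1) (hb : ∀ k : ℕ, α * b * q ^ k ≠ 1)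
    (hc : ∀ k : ℕ, c * q ^ k ≠ 1) (hd : ∀ k : ℕ, d * q ^ k ≠ 1)
    (he : ∀ k : ℕ, q * α / c * q ^ k ≠ 1) (h : ‖α * a * b / q‖ < 1) :
    HasSum (rhsTerm α a b c d β q)
      (qPochInf (α * q) q * qPochInf (α * a * b / q) q /
        (qPochInf (α * a) q * qPochInf (α * b) q) * ∑' n, phiTerm α a b c d β q n) := by
  have h0 : 0 < 1 - ‖q‖ := by linarith
  have hf := summable_phiTerm hq c d β h
  have hqj : ∀ j : ℕ, ‖q ^ j‖ ≤ 1 := fun j => by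
    rw [norm_pow]; exact pow_le_one₀ (norm_nonneg _) hq.le
  set T : ℕ × ℕ → ℂ := fun p => phiTerm α a b c d β q p.1 *
    (qPoch (α * q) q (2 * p.1) * vwpTerm α q (q ^ p.1) a b p.2) with hT
  -- The bound on `vwpTerm` is uniform in s = q^j, so T is dominated by a summable sequence in j
  -- times one in m.
  have hTs : Summable T := by
    have hB := (summable_vwp_bound α (R := max ‖a‖ ‖b‖) hq (by positivity)).mul_left
      (Real.exp (‖α * q‖ / (1 - ‖q‖)))
    refine .of_norm_bounded (hf.norm.mul_of_nonneg hB (fun _ => norm_nonneg _)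
      (fun m => by positivity)) fun p => ?_
    rw [hT, norm_mul, norm_mul]
    gcongr
    · exact norm_qPoch_le hq le_rfl _
    · exact norm_vwpTerm_le hq (hqj _) (le_max_left _ _) (le_max_right _ _) _
  -- Here α s² q = αq · q^{2j}, so (αq; q)_{2j} completes the product to (αq; q)_∞.
  have hTj : ∀ j, HasSum (fun m => T (j, m)) (phiTerm α a b c d β q j *
      (qPochInf (α * q) q * qPochInf (α * a * b / q) q)) := by
    intro j
    have hbj : ∀ k : ℕ, α * q ^ j * b * q ^ k ≠ 1 := fun k => by
      rw [show α * q ^ j * b * q ^ k = α * b * q ^ (j + k) by ring]; exact hb _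
    have := (summable_vwpTerm (α := α) hq (hqj j) a b).hasSum
    rw [tsum_vwpTerm hq0 hq (hqj j) hbj] at this
    have h1 := (this.mul_left (qPoch (α * q) q (2 * j))).mul_left (phiTerm α a b c d β q j)
    rwa [← mul_assoc (qPoch (α * q) q (2 * j)),
      show α * (q ^ j) ^ 2 * q = α * q * q ^ (2 * j) by ring, qPoch_mul_qPochInf _ hq] at h1
  have hsum : ∑' p, T p = (qPochInf (α * q) q * qPochInf (α * a * b / q) q) *
      ∑' n, phiTerm α a b c d β q n := by
    rw [mul_comm, ← tsum_mul_right]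
    exact (hTs.hasSum.prod_fiberwise hTj).tsum_eq.symm
  have hanti : HasSum (fun n => ∑ p ∈ antidiagonal n, T p) (∑' p, T p) := by
    have := (HasAntidiagonal.sigmaAntidiagonalEquivProd (A := ℕ)).hasSum_iff.2 hTs.hasSum
    refine this.sigma fun n => ?_
    exact Finset.hasSum (antidiagonal n) T
  have h1 := qPochInf_ne_zero hq ha
  have h2 := qPochInf_ne_zero hq hb
  rw [hsum] at hanti
  simp only [hT, sum_phiTerm_mul_vwpTerm hq0 hq β hc0 hα ha hb hc hd he] at hanti
  have h3 := hanti.mul_left (qPochInf (α * a) q * qPochInf (α * b) q)⁻¹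
  simp only [inv_mul_cancel_left₀ (mul_ne_zero h1 h2)] at h3
  rwa [div_mul_eq_mul_div, div_eq_inv_mul]

end Transformation

/-! ### Basic hypergeometric notation and Andrews' case. -/

section Specialization

variable {q : ℂ}

theorem basicHypergeometric_terminating (hq0 : q ≠ 0) (n : ℕ) {as bs : List ℂ} (z : ℂ)
    (has : as = q ^ (-(n : ℤ)) :: as.tail) :
    basicHypergeometric as bs q z =
      ∑ k ∈ range (n + 1), basicHypergeometricTerm as bs q z k := by
  refine tsum_eq_sum fun k hk => ?_
  rw [mem_range, not_lt] at hk
  rw [basicHypergeometricTerm, has, List.map_cons, List.prod_cons, qPoch_neg_zpow_eq_zero hq0 hk]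
  simp

theorem basicHypergeometric_three_two (hq0 : q ≠ 0) (n : ℕ) {β : ℂ} (hβ : β ≠ 0) (x c d e : ℂ) :
    basicHypergeometric [q ^ (-(n : ℤ)), x, d / β] [d, e] q (q * β / c) =
      ∑ k ∈ range (n + 1), qPoch (q ^ (-(n : ℤ))) q k * qPoch x q k *
        qDiffProd β d q k * (q / c) ^ k / (qPoch q q k * qPoch d q k * qPoch e q k) := by
  rw [basicHypergeometric_terminating hq0 n _ rfl]
  refine sum_congr rfl fun k _ => ?_
  rw [← qPoch_div_mul_pow hβ, basicHypergeometricTerm, mul_div_right_comm, mul_pow (q / c)]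
  simp
  ring

theorem basicHypergeometric_two_one (hq0 : q ≠ 0) (n : ℕ) (β x e : ℂ) :
    basicHypergeometric [q ^ (-(n : ℤ)), x] [e] q (q * β) =
      ∑ k ∈ range (n + 1), qPoch (q ^ (-(n : ℤ))) q k * qPoch x q k *
        qDiffProd (-q * β) 0 q k * (q / -q) ^ k / (qPoch q q k * qPoch 0 q k * qPoch e q k) := by
  rw [basicHypergeometric_terminating hq0 n _ rfl]
  refine sum_congr rfl fun k _ => ?_
  have h : qDiffProd (-q * β) 0 q k * (q / -q) ^ k = (q * β) ^ k := by
    rw [div_neg, div_self hq0]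
    simp [qDiffProd, ← mul_pow]
  rw [mul_assoc _ (qDiffProd _ _ _ _), h]
  simp [basicHypergeometricTerm, qPoch]
  ring

theorem qPoch_sq (x q : ℂ) (n : ℕ) :
    qPoch (x ^ 2) (q ^ 2) n = qPoch x q n * qPoch (-x) q n := by
  rw [qPoch, qPoch, qPoch, ← prod_mul_distrib]
  exact prod_congr rfl fun k _ => by ring

theorem qPochDivMulPow_zero_mul_self (q : ℂ) (n : ℕ) :
    qPochDivMulPow 0 q n * qPochDivMulPow 0 q n = q ^ (n ^ 2) * q ^ n := by
  induction n with
  | zero => simp [qPochDivMulPow]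
  | succ n ih =>
    simp only [qPochDivMulPow_eq_qDiffProd] at *
    rw [qDiffProd_succ, mul_mul_mul_comm, ih]
    ring

theorem phiTerm_andrews (hq0 : q ≠ 0) (α β : ℂ) (n : ℕ) :
    phiTerm α 0 0 (-q) 0 (-q * β) q n =
      q ^ (n ^ 2) * qPoch (-q * β) q n * α ^ n / qPoch (q ^ 2) (q ^ 2) n := by
  rw [phiTerm, qPochDivMulPow_zero_mul_self, qPoch_sq, div_pow]
  have h : qPoch 0 q n = 1 := by simp [qPoch]
  rw [h]
  field_simp

theorem rhsTerm_andrews (hq0 : q ≠ 0) (α β : ℂ) (n : ℕ) :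
    rhsTerm α 0 0 (-q) 0 (-q * β) q n =
      (1 - α * q ^ (2 * n)) * qPoch (α ^ 2) (q ^ 2) n * (-α) ^ n * q ^ (2 * n ^ 2) /
          ((1 - α) * qPoch (q ^ 2) (q ^ 2) n) *
        basicHypergeometric [q ^ (-(n : ℤ)), α * q ^ n] [-α] q (q * β) := by
  have h : qPoch 0 q n = 1 := by simp [qPoch]
  have hα : q * α / -q = -α := by field_simp
  have hp : (α * -q) ^ n * q ^ ((n : ℤ) ^ 2 - 2 * (n : ℤ)) * (q ^ (n ^ 2) * q ^ n) =
      (-α) ^ n * q ^ (2 * n ^ 2) := by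
    rw [show α * -q = -α * q by ring, mul_pow, zpow_sub₀ hq0,
      show (n : ℤ) ^ 2 = ((n ^ 2 : ℕ) : ℤ) by push_cast; rfl,
      show 2 * (n : ℤ) = ((2 * n : ℕ) : ℤ) by push_cast; rfl, zpow_natCast, zpow_natCast]
    field_simp
    ring
  rw [rhsTerm, basicHypergeometric_two_one hq0, mul_zero, h, hα, qPoch_sq, qPoch_sq,
    mul_assoc (qPoch α q n), qPochDivMulPow_zero_mul_self, mul_one, mul_one,
    mul_assoc (_ * _) ((-α) ^ n), ← hp]
  congr 2
  ring

end Specialization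

end

theorem mainTheorem4 (q : ℝ) (hq0 : 0 < q) (hq1 : q < 1) :
    -- the transformation formula, for nonzero `a` and `b`
    (∀ α a b c d β : ℂ,
      a ≠ 0 → b ≠ 0 → c ≠ 0 → β ≠ 0 → α ≠ 1 →
      (∀ k : ℕ, α * a * q ^ k ≠ 1) → (∀ k : ℕ, α * b * q ^ k ≠ 1) →
      (∀ k : ℕ, c * q ^ k ≠ 1) → (∀ k : ℕ, d * q ^ k ≠ 1) →
      (∀ k : ℕ, q * α / c * q ^ k ≠ 1) →
      ‖α * a * b / q‖ < 1 →
      Summable (basicHypergeometricTerm [q / a, q / b, β] [c, d] q (α * a * b / q)) ∧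
      HasSum
        (fun n : ℕ =>
          (1 - α * q ^ (2 * n)) *
              (qPoch α q n * qPoch (q / a) q n * qPoch (q / b) q n * qPoch (q * α / c) q n) *
              (α * a * b * c) ^ n * (q : ℂ) ^ ((n : ℤ) ^ 2 - 2 * (n : ℤ)) /
            ((1 - α) * (qPoch q q n * qPoch (α * a) q n * qPoch (α * b) q n * qPoch c q n)) *
            basicHypergeometric [(q : ℂ) ^ (-(n : ℤ)), α * q ^ n, d / β] [d, q * α / c] q
              (q * β / c))
        (qPochInf (α * q) q * qPochInf (α * a * b / q) q /
            (qPochInf (α * a) q * qPochInf (α * b) q) *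
          basicHypergeometric [q / a, q / b, β] [c, d] q (α * a * b / q))) ∧
    -- the same formula for all `a` and `b`, where `(q/a; q)_n a^n` and `(q/b; q)_n b^n`
    -- are read as their limits when `a = 0` or `b = 0`
    (∀ α a b c d β : ℂ,
      c ≠ 0 → β ≠ 0 → α ≠ 1 →
      (∀ k : ℕ, α * a * q ^ k ≠ 1) → (∀ k : ℕ, α * b * q ^ k ≠ 1) →
      (∀ k : ℕ, c * q ^ k ≠ 1) → (∀ k : ℕ, d * q ^ k ≠ 1) →
      (∀ k : ℕ, q * α / c * q ^ k ≠ 1) →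
      ‖α * a * b / q‖ < 1 →
      Summable (fun n : ℕ =>
        qPochDivMulPow a q n * qPochDivMulPow b q n * qPoch β q n /
          (qPoch q q n * qPoch c q n * qPoch d q n) * (α / q) ^ n) ∧
      HasSum
        (fun n : ℕ =>
          (1 - α * q ^ (2 * n)) *
              (qPoch α q n * qPochDivMulPow a q n * qPochDivMulPow b q n *
                qPoch (q * α / c) q n) *
              (α * c) ^ n * (q : ℂ) ^ ((n : ℤ) ^ 2 - 2 * (n : ℤ)) /
            ((1 - α) * (qPoch q q n * qPoch (α * a) q n * qPoch (α * b) q n * qPoch c q n)) *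
            basicHypergeometric [(q : ℂ) ^ (-(n : ℤ)), α * q ^ n, d / β] [d, q * α / c] q
              (q * β / c))
        (qPochInf (α * q) q * qPochInf (α * a * b / q) q /
            (qPochInf (α * a) q * qPochInf (α * b) q) *
          ∑' n : ℕ, qPochDivMulPow a q n * qPochDivMulPow b q n * qPoch β q n /
            (qPoch q q n * qPoch c q n * qPoch d q n) * (α / q) ^ n)) ∧
    -- the special case `a = b = d = 0`, `c = -q`, with `-qβ` for `β` (Andrews)
    (∀ α β : ℂ,
      α ≠ 1 → (∀ k : ℕ, q * α * q ^ k ≠ 1) → (∀ k : ℕ, -α * q ^ k ≠ 1) →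
      Summable (fun n : ℕ =>
        (q : ℂ) ^ (n ^ 2) * qPoch (-q * β) q n * α ^ n / qPoch (q ^ 2) (q ^ 2) n) ∧
      Summable (fun n : ℕ =>
        (1 - α * q ^ (2 * n)) * qPoch (α ^ 2) (q ^ 2) n * (-α) ^ n * q ^ (2 * n ^ 2) /
            ((1 - α) * qPoch (q ^ 2) (q ^ 2) n) *
          basicHypergeometric [(q : ℂ) ^ (-(n : ℤ)), α * q ^ n] [-α] q (q * β)) ∧
      ∑' n : ℕ, (q : ℂ) ^ (n ^ 2) * qPoch (-q * β) q n * α ^ n / qPoch (q ^ 2) (q ^ 2) n =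
        1 / qPochInf (q * α) q *
          ∑' n : ℕ,
            (1 - α * q ^ (2 * n)) * qPoch (α ^ 2) (q ^ 2) n * (-α) ^ n * q ^ (2 * n ^ 2) /
                ((1 - α) * qPoch (q ^ 2) (q ^ 2) n) *
              basicHypergeometric [(q : ℂ) ^ (-(n : ℤ)), α * q ^ n] [-α] q (q * β)) := by
  have hqn : ‖(q : ℂ)‖ < 1 := by
    rwa [Complex.norm_real, Real.norm_of_nonneg hq0.le]
  have hqc : (q : ℂ) ≠ 0 := Complex.ofReal_ne_zero.2 hq0.ne'
  have main : ∀ α a b c d β : ℂ,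
      c ≠ 0 → β ≠ 0 → α ≠ 1 →
      (∀ k : ℕ, α * a * q ^ k ≠ 1) → (∀ k : ℕ, α * b * q ^ k ≠ 1) →
      (∀ k : ℕ, c * q ^ k ≠ 1) → (∀ k : ℕ, d * q ^ k ≠ 1) →
      (∀ k : ℕ, q * α / c * q ^ k ≠ 1) →
      ‖α * a * b / q‖ < 1 →
      Summable (phiTerm α a b c d β q) ∧
      HasSum
        (fun n : ℕ =>
          (1 - α * q ^ (2 * n)) *
              (qPoch α q n * qPochDivMulPow a q n * qPochDivMulPow b q n *
                qPoch (q * α / c) q n) *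
              (α * c) ^ n * (q : ℂ) ^ ((n : ℤ) ^ 2 - 2 * (n : ℤ)) /
            ((1 - α) * (qPoch q q n * qPoch (α * a) q n * qPoch (α * b) q n * qPoch c q n)) *
            basicHypergeometric [(q : ℂ) ^ (-(n : ℤ)), α * q ^ n, d / β] [d, q * α / c] q
              (q * β / c))
        (qPochInf (α * q) q * qPochInf (α * a * b / q) q /
            (qPochInf (α * a) q * qPochInf (α * b) q) *
          ∑' n : ℕ, phiTerm α a b c d β q n) := by
    intro α a b c d β hc0 hβ hα ha hb hc hd he h
    refine ⟨summable_phiTerm hqn c d β h, ?_⟩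
    simp only [basicHypergeometric_three_two hqc _ hβ]
    exact hasSum_rhsTerm hqc hqn β hc0 hα ha hb hc hd he h
  refine ⟨fun α a b c d β ha0 hb0 hc0 hβ hα ha hb hc hd he h => ?_, main, fun α β hα h1 h2 => ?_⟩
  · obtain ⟨hs, hS⟩ := main α a b c d β hc0 hβ hα ha hb hc hd he h
    have e : phiTerm α a b c d β q =
        basicHypergeometricTerm [q / a, q / b, β] [c, d] q (α * a * b / q) := by
      funext n
      rw [phiTerm, qPochDivMulPow_of_ne_zero ha0, qPochDivMulPow_of_ne_zero hb0,
        basicHypergeometricTerm, show α * a * b / q = a * b * (α / q) by ring,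
        mul_pow (a * b), mul_pow a]
      simp
      ring
    rw [e] at hs hS
    refine ⟨hs, ?_⟩
    rw [basicHypergeometric]
    convert hS using 3 with n
    rw [qPochDivMulPow_of_ne_zero ha0, qPochDivMulPow_of_ne_zero hb0]
    ring
  · have hc : ∀ k : ℕ, -(q : ℂ) * q ^ k ≠ 1 := fun k hk => by
      have := congrArg norm hk
      rw [neg_mul, norm_neg, ← pow_succ', norm_pow, norm_one] at this
      exact (pow_lt_one₀ (norm_nonneg _) hqn k.succ_ne_zero).ne this
    have h0 : ‖α * 0 * 0 / (q : ℂ)‖ < 1 := by simp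
    have he : ∀ k : ℕ, q * α / -q * (q : ℂ) ^ k ≠ 1 := fun k => by
      rw [show q * α / -q = -α by field_simp]; exact h2 k
    have hs := summable_phiTerm hqn (-q) 0 (-q * β) h0
    -- `main` requires a nonzero last parameter; `hasSum_rhsTerm` is polynomial in it and so also
    -- covers β = 0.
    have hS := hasSum_rhsTerm hqc hqn (d := 0) (-q * β) (neg_ne_zero.2 hqc) hα
      (by simp) (by simp) hc (by simp) he h0
    rw [funext (phiTerm_andrews hqc α β)] at hs hS
    rw [funext (rhsTerm_andrews hqc α β)] at hS
    refine ⟨hs, hS.summable, ?_⟩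
    rw [hS.tsum_eq]
    have hne := qPochInf_ne_zero hqn h1
    simp only [mul_zero, zero_div, qPochInf_zero, mul_one, div_one]
    rw [mul_comm α, one_div, inv_mul_cancel_left₀ hne]
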